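/- For nonnegative integers $r,k$, let the Johnson graph $J(r,k)$ be the graph whose vertices are the $k$-element subsets of an $r$-element set, two of them being adjacent if and only if their intersection has exactly $k-1$ elements. Let $G=J(r,k)$, let $n$ be its number of vertices, $\alpha(G)$ its independence number (the largest size of a set of pairwise non-adjacent vertices), $\lambda_1\ge\dots\ge\lambda_n$ the eigenvalues of its adjacency matrix, counted with multiplicity, and $\mathcal{E}(G)=\sum_{i=1}^n|\lambda_i|$ its energy. Then, for all nonnegative integers $r$ and $k$, $$\sum_{\lambda_i>0}\lambda_i=\frac12\,\mathcal{E}(G)\ \ge\ n-\alpha(G).$$ (In the degenerate case $k>r$ the graph has no vertices and all quantities are $0$.) -/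

import Mathlib

open scoped BigOperators

noncomputable section

namespace SimpleGraph

/-- The eigenvalues of the real adjacency matrix of a finite graph, listed with multiplicity
(one for each vertex index). -/
def adjEigenvalue {V : Type*} [Fintype V] [DecidableEq V] (G : SimpleGraph V)
    [DecidableRel G.Adj] : V → ℝ :=
  (G.isHermitian_adjMatrix ℝ).eigenvalues

/-- The energy of a finite graph: the sum of the absolute values of its adjacency eigenvalues,
counted with multiplicity. -/
def energy {V : Type*} [Fintype V] [DecidableEq V] (G : SimpleGraph V)
    [DecidableRel G.Adj] : ℝ :=
  ∑ i, |G.adjEigenvalue i|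

end SimpleGraph

end

/-- The vertices of the Johnson graph: the `k`-element subsets of an `r`-element set. -/
abbrev JohnsonVertex (r k : ℕ) : Type :=
  {s : Finset (Fin r) // s.card = k}

/-- The Johnson graph `J(r, k)`: two `k`-subsets are adjacent exactly when they have `k - 1`
elements in common. -/
def johnsonGraph (r k : ℕ) : SimpleGraph (JohnsonVertex r k) where
  Adj s t := (s.1 ∩ t.1).card + 1 = k
  symm := ⟨fun s t h => by rw [Finset.inter_comm]; exact h⟩
  loopless := ⟨fun s h => by
    have hs := s.2
    rw [Finset.inter_self] at h
    omega⟩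

instance (r k : ℕ) : DecidableRel (johnsonGraph r k).Adj :=
  fun s t => inferInstanceAs (Decidable ((s.1 ∩ t.1).card + 1 = k))

/-! The trace is zero, so half the energy is the sum of the absolute values of the negative
eigenvalues, and it suffices to exhibit enough of these. With `W` the inclusion matrix of
(k-1)-subsets in k-subsets, `Wᵀ * W = A + k`, so -k has multiplicity at least n - C(r,k-1). For r >
2k ≥ 4 this alone contributes at least n. For r < 2k, (k+1)-subsets and the eigenvalue k-r play the
mirror role. For r = 2k the contribution of -k is only kn/(k+1); when k ≥ 3 the eigenvalue 2-k,
found by factoring (A+k)(A+k-2) through (k-2)-subsets, fills the gap. The independence number enters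
only for complete graphs (one vertex included) and J(4,2). -/

open Polynomial Matrix in
/-- At least `n - rank q(A)` eigenvalues of a real symmetric matrix `A` are roots of `q`. -/
theorem Matrix.IsHermitian.card_sub_rank_aeval_le {V : Type*} [Fintype V] [DecidableEq V]
    {A : Matrix V V ℝ} (hA : A.IsHermitian) (q : ℝ[X]) :
    (Fintype.card V : ℝ) - (aeval A q).rank
      ≤ (Finset.univ.filter fun i => q.eval (hA.eigenvalues i) = 0).card := by
  have key : aeval A q = Unitary.conjStarAlgAut ℝ _ hA.eigenvectorUnitary
      (diagonal fun i => q.eval (hA.eigenvalues i)) := by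
    conv_lhs => rw [hA.spectral_theorem]
    rw [aeval_algHom_apply (F := Matrix V V ℝ ≃⋆ₐ[ℝ] Matrix V V ℝ)]
    congr 1
    have h := aeval_algHom_apply (diagonalAlgHom ℝ (n := V) (α := ℝ)) hA.eigenvalues q
    rw [diagonalAlgHom_apply, diagonalAlgHom_apply] at h
    refine h.trans (congrArg _ (funext fun i => ?_))
    simp
  have hr : (aeval A q).rank = (Finset.univ.filter fun i => q.eval (hA.eigenvalues i) ≠ 0).card := by
    rw [key, Unitary.conjStarAlgAut_apply, ← Unitary.coe_star]
    simp [-isUnit_iff_ne_zero, -Unitary.coe_star, rank_diagonal, Fintype.card_subtype]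
  have hs := Finset.card_filter_add_card_filter_not (s := (Finset.univ : Finset V))
    (fun i => q.eval (hA.eigenvalues i) = 0)
  rw [Finset.card_univ] at hs
  rw [hr, ← hs]
  push_cast
  linarith

/-! ### Energy bounds from the ranks of polynomials in the adjacency matrix. -/

namespace SimpleGraph

variable {V : Type*} [Fintype V] [DecidableEq V] (G : SimpleGraph V) [DecidableRel G.Adj]

theorem sum_adjEigenvalue : ∑ i, G.adjEigenvalue i = 0 := by
  have h := (G.isHermitian_adjMatrix ℝ).trace_eq_sum_eigenvalues
  rw [trace_adjMatrix] at h
  simpa [adjEigenvalue] using h.symm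

theorem sum_pos_adjEigenvalue :
    (∑ i with 0 < G.adjEigenvalue i, G.adjEigenvalue i) = (1 / 2 : ℝ) * G.energy := by
  have h : (∑ i with 0 < G.adjEigenvalue i, G.adjEigenvalue i)
      = ∑ i, (1 / 2 : ℝ) * (|G.adjEigenvalue i| + G.adjEigenvalue i) := by
    rw [Finset.sum_filter]
    refine Finset.sum_congr rfl fun i _ => ?_
    split_ifs with hi
    · rw [abs_of_pos hi]; ring
    · rw [abs_of_nonpos (not_lt.mp hi)]; ring
  rw [h, ← Finset.mul_sum, Finset.sum_add_distrib, sum_adjEigenvalue, add_zero, energy]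

/-- A function dominated by the negative part of the eigenvalues sums to at most half the
energy. -/
theorem sum_le_half_energy (f : V → ℝ) (h0 : ∀ i, f i ≤ 0 ∨ f i ≤ -G.adjEigenvalue i) :
    ∑ i, f i ≤ (1 / 2 : ℝ) * G.energy := by
  have h : (1 / 2 : ℝ) * G.energy
      = ∑ i, (1 / 2 : ℝ) * (|G.adjEigenvalue i| - G.adjEigenvalue i) := by
    rw [← Finset.mul_sum, Finset.sum_sub_distrib, sum_adjEigenvalue, sub_zero, energy]
  rw [h]
  refine Finset.sum_le_sum fun i _ => ?_
  rcases h0 i with h1 | h1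
  · linarith [le_abs_self (G.adjEigenvalue i)]
  · linarith [neg_le_abs (G.adjEigenvalue i)]

theorem card_sub_rank_le (q : Polynomial ℝ) {m : ℕ}
    (hm : (Polynomial.aeval (G.adjMatrix ℝ) q).rank ≤ m) :
    (Fintype.card V : ℝ) - m
      ≤ (Finset.univ.filter fun i => q.eval (G.adjEigenvalue i) = 0).card := by
  have h := (G.isHermitian_adjMatrix ℝ).card_sub_rank_aeval_le q
  have hm' : ((Polynomial.aeval (G.adjMatrix ℝ) q).rank : ℝ) ≤ m := by exact_mod_cast hm
  have : (Fintype.card V : ℝ) - m ≤ Fintype.card V - (Polynomial.aeval (G.adjMatrix ℝ) q).rank := by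
    linarith
  exact this.trans h

/-- If `A + c` has rank at most `m`, then `-c` is an eigenvalue of multiplicity at least `n - m`. -/
theorem mul_card_sub_le_half_energy {c : ℝ} (hc : 0 ≤ c) {m : ℕ}
    (hm : (G.adjMatrix ℝ + c • 1).rank ≤ m) :
    c * ((Fintype.card V : ℝ) - m) ≤ (1 / 2 : ℝ) * G.energy := by
  have h := G.card_sub_rank_le (Polynomial.X + Polynomial.C c) (m := m)
    (by simpa [Algebra.algebraMap_eq_smul_one] using hm)
  refine (mul_le_mul_of_nonneg_left h hc).trans ?_
  refine le_trans (le_of_eq ?_) (G.sum_le_half_energy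
    (fun i => if G.adjEigenvalue i + c = 0 then c else 0) fun i => ?_)
  · simp [← Finset.sum_filter, mul_comm]
  · split_ifs with hi
    · exact Or.inr (by linarith)
    · exact Or.inl le_rfl

/-- If `A + c` and `(A + c) (A + c - 2)` have rank at most `m` and `m'`, then the eigenvalues `-c`
and `2 - c` contribute to the energy accordingly. -/
theorem two_eigenvalues_le_half_energy {c : ℝ} (hc : 2 ≤ c) {m m' : ℕ}
    (hm : (G.adjMatrix ℝ + c • 1).rank ≤ m)
    (hm' : ((G.adjMatrix ℝ + c • 1) * (G.adjMatrix ℝ + c • 1)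
      - (2 : ℝ) • (G.adjMatrix ℝ + c • 1)).rank ≤ m') :
    2 * ((Fintype.card V : ℝ) - m) + (c - 2) * ((Fintype.card V : ℝ) - m')
      ≤ (1 / 2 : ℝ) * G.energy := by
  have h := G.card_sub_rank_le (Polynomial.X + Polynomial.C c) (m := m)
    (by simpa [Algebra.algebraMap_eq_smul_one] using hm)
  have h' := G.card_sub_rank_le ((Polynomial.X + Polynomial.C c) * (Polynomial.X + Polynomial.C c)
      - (2 : ℝ) • (Polynomial.X + Polynomial.C c)) (m := m')
    (by simpa only [map_sub, map_mul, map_add, map_smul, Polynomial.aeval_X, Polynomial.aeval_C,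
          Algebra.algebraMap_eq_smul_one] using hm')
  refine (add_le_add (mul_le_mul_of_nonneg_left h zero_le_two)
    (mul_le_mul_of_nonneg_left h' (sub_nonneg.mpr hc))).trans ?_
  refine le_trans (le_of_eq ?_) (G.sum_le_half_energy
    -- The eigenvalue -c is a root of both polynomials and collects 2 + (c - 2) = c; 2 - c is a root
    -- of the quadratic only and collects c - 2.
    (fun i => (if G.adjEigenvalue i + c = 0 then 2 else 0)
      + if (G.adjEigenvalue i + c) * (G.adjEigenvalue i + c) - 2 * (G.adjEigenvalue i + c) = 0
        then c - 2 else 0) fun i => ?_)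
  · rw [Finset.sum_add_distrib, ← Finset.sum_filter, ← Finset.sum_filter, Finset.sum_const,
      Finset.sum_const, nsmul_eq_mul, nsmul_eq_mul, mul_comm 2, mul_comm (c - 2)]
    simp only [Polynomial.eval_add, Polynomial.eval_sub, Polynomial.eval_mul, Polynomial.eval_smul,
      Polynomial.eval_X, Polynomial.eval_C, smul_eq_mul]
  · split_ifs with h1 h2 h2
    · exact Or.inr (by linarith)
    · exact absurd (by rw [h1]; ring) h2
    · have h3 : (G.adjEigenvalue i + c) * (G.adjEigenvalue i + c - 2) = 0 := by linarith
      rcases mul_eq_zero.mp h3 with h4 | h4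
      · exact absurd h4 h1
      · exact Or.inr (by linarith)
    · exact Or.inl (by norm_num)

end SimpleGraph

/-! ### Inclusion matrices and rank bounds. -/

/-- The inclusion matrix of `a`-subsets against `b`-subsets of an `r`-element set. -/
def subsetInclusionMatrix (r a b : ℕ) : Matrix (JohnsonVertex r a) (JohnsonVertex r b) ℝ :=
  fun s t => if s.1 ⊆ t.1 then 1 else 0

theorem card_johnsonVertex (r k : ℕ) : Fintype.card (JohnsonVertex r k) = r.choose k := by
  simp [JohnsonVertex, Fintype.card_finset_len]

theorem card_filter_subset_card_eq (r a : ℕ) (u : Finset (Fin r)) :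
    (Finset.univ.filter fun s : JohnsonVertex r a => s.1 ⊆ u).card = u.card.choose a := by
  rw [← Finset.card_powersetCard]
  refine Finset.card_bij (fun s _ => s.1) (fun s hs => ?_) (fun s _ t _ h => Subtype.ext h)
    fun s hs => ?_
  · simpa [Finset.mem_powersetCard, s.2] using hs
  · rw [Finset.mem_powersetCard] at hs
    exact ⟨⟨s, hs.2⟩, by simpa using hs.1, rfl⟩

/-- Counting the omitted elements keeps the formula correct (zero) when `u` has more than `b`
elements, where `b - u.card` would truncate. -/
theorem card_filter_superset_card_eq (r b : ℕ) (hb : b ≤ r) (u : Finset (Fin r)) :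
    (Finset.univ.filter fun s : JohnsonVertex r b => u ⊆ s.1).card
      = (r - u.card).choose (r - b) := by
  have h : (r - u.card) = uᶜ.card := by simp [Finset.card_compl]
  rw [h, ← card_filter_subset_card_eq]
  refine Finset.card_bij (fun s _ => ⟨s.1ᶜ, by simp [Finset.card_compl, s.2]⟩) (fun s hs => ?_)
    (fun s _ t _ h => ?_) fun s hs => ?_
  · simpa using hs
  · simpa [Subtype.ext_iff] using h
  · refine ⟨⟨s.1ᶜ, ?_⟩, ?_, ?_⟩
    · rw [Finset.card_compl, s.2, Fintype.card_fin]; omega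
    · have := (Finset.mem_filter.mp hs).2
      simpa [Finset.subset_compl_comm] using this
    · simp

theorem johnsonVertex_ext_of_card_inter {r k : ℕ} {s t : JohnsonVertex r k}
    (h : k ≤ (s.1 ∩ t.1).card) : s = t := by
  have h1 : s.1 ∩ t.1 = s.1 := Finset.eq_of_subset_of_card_le Finset.inter_subset_left (by
    rw [s.2]; exact h)
  have h2 : s.1 ∩ t.1 = t.1 := Finset.eq_of_subset_of_card_le Finset.inter_subset_right (by
    rw [t.2]; exact h)
  exact Subtype.ext (h1.symm.trans h2)

open Matrix in
-- The entry at `s`, `t` counts the `a`-subsets of `s ∩ t`: `a + 1` on the diagonal, 1 for adjacent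
-- vertices, 0 otherwise.
theorem transpose_mul_subsetInclusionMatrix (r a : ℕ) :
    (subsetInclusionMatrix r a (a + 1))ᵀ * subsetInclusionMatrix r a (a + 1)
      = (johnsonGraph r (a + 1)).adjMatrix ℝ + ((a : ℝ) + 1) • 1 := by
  ext s t
  have h : ((subsetInclusionMatrix r a (a + 1))ᵀ * subsetInclusionMatrix r a (a + 1)) s t
      = ((s.1 ∩ t.1).card.choose a : ℝ) := by
    rw [← card_filter_subset_card_eq]
    simp [Matrix.mul_apply, subsetInclusionMatrix, Finset.subset_inter_iff, ← ite_and, and_comm]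
  rw [h]
  by_cases hst : s = t
  · subst hst
    simp [s.2]
  · have hlt : (s.1 ∩ t.1).card < a + 1 := by
      by_contra! hc
      exact hst (johnsonVertex_ext_of_card_inter hc)
    by_cases hadj : (s.1 ∩ t.1).card + 1 = a + 1
    · have : (johnsonGraph r (a + 1)).Adj s t := hadj
      have ha : (s.1 ∩ t.1).card = a := by omega
      simp [hst, this, ha]
    · have : ¬ (johnsonGraph r (a + 1)).Adj s t := hadj
      simp [hst, this, Nat.choose_eq_zero_of_lt (show (s.1 ∩ t.1).card < a by omega)]

open Matrix in
theorem subsetInclusionMatrix_mul_transpose (r a : ℕ) (har : a + 1 ≤ r) :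
    subsetInclusionMatrix r a (a + 1) * (subsetInclusionMatrix r a (a + 1))ᵀ
      = (johnsonGraph r a).adjMatrix ℝ + ((r : ℝ) - a) • 1 := by
  ext s t
  have h : (subsetInclusionMatrix r a (a + 1) * (subsetInclusionMatrix r a (a + 1))ᵀ) s t
      = ((r - (s.1 ∪ t.1).card).choose (r - (a + 1)) : ℝ) := by
    rw [← card_filter_superset_card_eq r (a + 1) har]
    simp [Matrix.mul_apply, subsetInclusionMatrix, Finset.union_subset_iff, ← ite_and, and_comm]
  have hu := Finset.card_union_add_card_inter s.1 t.1
  rw [s.2, t.2] at hu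
  rw [h]
  by_cases hst : s = t
  · subst hst
    have : r - a = r - (a + 1) + 1 := by omega
    have h' : ((r - (a + 1) : ℕ) : ℝ) = (r : ℝ) - (a + 1) := by push_cast [har]; ring
    simp only [Finset.union_self, s.2, this, Nat.choose_succ_self_right]
    simp [h']
    ring
  · have hlt : (s.1 ∩ t.1).card < a := by
      by_contra! hc
      exact hst (johnsonVertex_ext_of_card_inter hc)
    by_cases hadj : (s.1 ∩ t.1).card + 1 = a
    · have : (johnsonGraph r a).Adj s t := hadj
      have ha : (s.1 ∪ t.1).card = a + 1 := by omega
      simp [hst, this, ha]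
    · have : ¬ (johnsonGraph r a).Adj s t := hadj
      have hur : (s.1 ∪ t.1).card ≤ r := (Finset.card_le_univ _).trans_eq (Fintype.card_fin r)
      simp [hst, this, Nat.choose_eq_zero_of_lt
        (show r - (s.1 ∪ t.1).card < r - (a + 1) by omega)]

theorem rank_adjMatrix_add_le_choose_pred (r a : ℕ) :
    ((johnsonGraph r (a + 1)).adjMatrix ℝ + ((a : ℝ) + 1) • 1).rank ≤ r.choose a := by
  rw [← transpose_mul_subsetInclusionMatrix, ← card_johnsonVertex]
  exact (Matrix.rank_mul_le_right _ _).trans (Matrix.rank_le_card_height _)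

theorem rank_adjMatrix_add_le_choose_succ (r a : ℕ) (har : a + 1 ≤ r) :
    ((johnsonGraph r a).adjMatrix ℝ + ((r : ℝ) - a) • 1).rank ≤ r.choose (a + 1) := by
  rw [← subsetInclusionMatrix_mul_transpose r a har, ← card_johnsonVertex]
  exact (Matrix.rank_mul_le_left _ _).trans (Matrix.rank_le_card_width _)

open Matrix in
theorem rank_quadratic_middle_le_choose (a : ℕ) :
    (((johnsonGraph (2 * (a + 2)) (a + 2)).adjMatrix ℝ + ((a : ℝ) + 2) • 1)
        * ((johnsonGraph (2 * (a + 2)) (a + 2)).adjMatrix ℝ + ((a : ℝ) + 2) • 1)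
      - (2 : ℝ) • ((johnsonGraph (2 * (a + 2)) (a + 2)).adjMatrix ℝ + ((a : ℝ) + 2) • 1)).rank
      ≤ (2 * (a + 2)).choose a := by
  set r := 2 * (a + 2) with hr
  set W := subsetInclusionMatrix r (a + 1) (a + 2)
  set W' := subsetInclusionMatrix r a (a + 1)
  have h1 : Wᵀ * W = (johnsonGraph r (a + 2)).adjMatrix ℝ + ((a : ℝ) + 2) • 1 := by
    rw [transpose_mul_subsetInclusionMatrix r (a + 1)]
    push_cast
    ring_nf
  -- Both products are the adjacency matrix of `J(r, a + 1)` plus a scalar: `a + 3` on the left, `a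
  -- + 1` on the right.
  have h2 : W * Wᵀ = W'ᵀ * W' + (2 : ℝ) • 1 := by
    rw [transpose_mul_subsetInclusionMatrix r a,
      subsetInclusionMatrix_mul_transpose r (a + 1) (by omega), add_assoc, ← add_smul]
    congr 2
    rw [hr]
    push_cast
    ring
  have h3 : (Wᵀ * W) * (Wᵀ * W) - (2 : ℝ) • (Wᵀ * W) = (Wᵀ * W'ᵀ) * (W' * W) := by
    have : (Wᵀ * W) * (Wᵀ * W) = Wᵀ * (W * Wᵀ) * W := by simp only [Matrix.mul_assoc]
    rw [this, h2, Matrix.mul_add, Matrix.add_mul]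
    simp [Matrix.mul_assoc]
  rw [← h1, h3, ← card_johnsonVertex]
  exact (Matrix.rank_mul_le_right _ _).trans (Matrix.rank_le_card_height _)

/-! ### Independent sets for the small cases. -/

theorem one_le_indepNum_johnsonGraph {r k : ℕ} (hk : k ≤ r) : 1 ≤ (johnsonGraph r k).indepNum := by
  have : 0 < Fintype.card (JohnsonVertex r k) := by
    rw [card_johnsonVertex]; exact Nat.choose_pos hk
  obtain ⟨s⟩ := Fintype.card_pos_iff.mp this
  have h : (johnsonGraph r k).IsIndepSet (({s} : Finset _) : Set (JohnsonVertex r k)) := by simp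
  simpa using h.card_le_indepNum

theorem two_le_indepNum_johnsonGraph_four_two : 2 ≤ (johnsonGraph 4 2).indepNum := by
  have h : (johnsonGraph 4 2).IsIndepSet
      (({⟨{0, 1}, rfl⟩, ⟨{2, 3}, rfl⟩} : Finset (JohnsonVertex 4 2)) : Set (JohnsonVertex 4 2)) := by
    intro s hs t ht hst
    simp only [Finset.coe_insert, Finset.coe_singleton, Set.mem_insert_iff,
      Set.mem_singleton_iff] at hs ht
    rcases hs with rfl | rfl <;> rcases ht with rfl | rfl
    · exact absurd rfl hst
    · decide
    · decide
    · exact absurd rfl hst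
  have h' := h.card_le_indepNum
  rwa [show (({⟨{0, 1}, rfl⟩, ⟨{2, 3}, rfl⟩} : Finset (JohnsonVertex 4 2))).card = 2 from rfl] at h'

/-! ### Binomial inequalities. -/

/-- The elementary inequality behind the case `r ≠ 2 k`. -/
theorem choose_le_mul_choose_sub {r a : ℕ} (ha : 1 ≤ a) (hr : 2 * (a + 1) < r) :
    (r.choose (a + 1) : ℝ) ≤ ((a : ℝ) + 1) * ((r.choose (a + 1) : ℝ) - r.choose a) := by
  have h : (r.choose (a + 1) : ℝ) * (a + 1) = r.choose a * ((r : ℝ) - a) := by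
    have := Nat.choose_succ_right_eq r a
    rw [← Nat.cast_sub (by omega)]
    exact_mod_cast this
  have hr' : (2 * (a + 1) + 1 : ℝ) ≤ r := by exact_mod_cast hr
  have ha' : (1 : ℝ) ≤ a := by exact_mod_cast ha
  have hx : (0 : ℝ) ≤ r.choose a := Nat.cast_nonneg _
  -- As r ≥ 2a + 3, the second factor is at least a(a + 3) - (a + 1)² = a - 1.
  have h2 : (0 : ℝ) ≤ r.choose a * (a * ((r : ℝ) - a) - (a + 1) ^ 2) :=
    mul_nonneg hx (by nlinarith)
  have h3 : (0 : ℝ) ≤ (a + 1) * (a * (r.choose (a + 1) : ℝ) - (a + 1) * r.choose a) := by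
    nlinarith
  have h4 := nonneg_of_mul_nonneg_right h3 (by positivity)
  linarith

theorem choose_middle_le {a : ℕ} (ha : 1 ≤ a) :
    ((2 * (a + 2)).choose (a + 2) : ℝ) ≤
      2 * (((2 * (a + 2)).choose (a + 2) : ℝ) - (2 * (a + 2)).choose (a + 1))
        + ((a : ℝ) + 2 - 2) * (((2 * (a + 2)).choose (a + 2) : ℝ) - (2 * (a + 2)).choose a) := by
  have h1 : ((2 * (a + 2)).choose (a + 2) : ℝ) * (a + 2)
      = (2 * (a + 2)).choose (a + 1) * (a + 3) := by
    have := Nat.choose_succ_right_eq (2 * (a + 2)) (a + 1)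
    rw [show 2 * (a + 2) - (a + 1) = a + 3 by omega] at this
    exact_mod_cast this
  have h2 : ((2 * (a + 2)).choose (a + 1) : ℝ) * (a + 1) = (2 * (a + 2)).choose a * (a + 4) := by
    have := Nat.choose_succ_right_eq (2 * (a + 2)) a
    rw [show 2 * (a + 2) - a = a + 4 by omega] at this
    exact_mod_cast this
  have ha' : (1 : ℝ) ≤ a := by exact_mod_cast ha
  have hz : (0 : ℝ) ≤ (2 * (a + 2)).choose a := Nat.cast_nonneg _
  generalize ((2 * (a + 2)).choose (a + 2) : ℝ) = n at *
  generalize ((2 * (a + 2)).choose (a + 1) : ℝ) = x at *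
  generalize ((2 * (a + 2)).choose a : ℝ) = z at *
  have hx : x = z * (a + 4) / (a + 1) := by field_simp; linarith
  have hn : n = z * (a + 4) * (a + 3) / ((a + 1) * (a + 2)) := by
    rw [hx] at h1; field_simp at h1 ⊢; linarith
  -- At a = 0 the quadratic is negative, which is why k = 2 needs separate treatment.
  have h3 : 2 * (n - x) + (a + 2 - 2) * (n - z) - n
      = z * (3 * a ^ 2 + 5 * a - 4) / ((a + 1) * (a + 2)) := by
    rw [hn, hx]; field_simp; ring
  have h4 : 0 ≤ z * (3 * a ^ 2 + 5 * a - 4) / ((a + 1) * (a + 2)) := by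
    refine div_nonneg (mul_nonneg hz (by nlinarith)) (by positivity)
  linarith

/-! ### Case analysis on r against 2k. -/

theorem card_sub_indepNum_le_half_energy_johnsonGraph (r k : ℕ) :
    (Fintype.card (JohnsonVertex r k) : ℝ) - ((johnsonGraph r k).indepNum : ℝ)
      ≤ (1 / 2 : ℝ) * (johnsonGraph r k).energy := by
  have hα0 : (0 : ℝ) ≤ (johnsonGraph r k).indepNum := Nat.cast_nonneg _
  have hE0 : 0 ≤ (1 / 2 : ℝ) * (johnsonGraph r k).energy :=
    mul_nonneg (by norm_num) (Finset.sum_nonneg fun i _ => abs_nonneg _)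
  rcases lt_or_ge r k with hrk | hkr
  · rw [card_johnsonVertex, Nat.choose_eq_zero_of_lt hrk, Nat.cast_zero]
    linarith
  have hα : (1 : ℝ) ≤ (johnsonGraph r k).indepNum := by
    exact_mod_cast one_le_indepNum_johnsonGraph hkr
  rcases lt_trichotomy r (2 * k) with h | h | h
  · obtain ⟨b, rfl⟩ := Nat.exists_eq_add_of_le hkr
    rcases b with _ | b
    · rw [card_johnsonVertex]
      simp only [add_zero, Nat.choose_self, Nat.cast_one]
      linarith
    have hE := (johnsonGraph (k + (b + 1)) k).mul_card_sub_le_half_energy (by simp; positivity)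
      (rank_adjMatrix_add_le_choose_succ (k + (b + 1)) k (by omega))
    rw [card_johnsonVertex] at hE ⊢
    have e1 : (k + (b + 1)).choose k = (k + (b + 1)).choose (b + 1) := Nat.choose_symm_add
    have e2 : (k + (b + 1)).choose (k + 1) = (k + (b + 1)).choose b := by
      -- Passing to complements, with r - k = b + 1, gives the binomials of the case r > 2k.
      rw [← Nat.choose_symm_of_eq_add (show k + (b + 1) = (k + 1) + b by ring)]
    rw [e1, e2, show ((k + (b + 1) : ℕ) : ℝ) - k = b + 1 by push_cast; ring] at hE
    rw [e1]
    rcases Nat.eq_zero_or_pos b with rfl | hb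
    · simp at hE ⊢
      linarith
    · have := choose_le_mul_choose_sub (r := k + (b + 1)) hb (by omega)
      linarith
  · subst h
    rcases k with _ | _ | _ | a
    · rw [card_johnsonVertex]
      simp only [mul_zero, Nat.choose_self, Nat.cast_one] at hα hE0 ⊢
      linarith
    · have hE := (johnsonGraph (2 * (0 + 1)) (0 + 1)).mul_card_sub_le_half_energy (by simp)
        (rank_adjMatrix_add_le_choose_pred (2 * (0 + 1)) 0)
      simp only [Nat.choose_zero_right, Nat.cast_zero, zero_add, one_mul, Nat.cast_one] at hE hα ⊢
      linarith
    -- Here n = 6 and the eigenvalue -2 gives 2(6 - 4) = 4, so an independent pair is needed.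
    · have hE := (johnsonGraph 4 2).mul_card_sub_le_half_energy (by positivity)
        (rank_adjMatrix_add_le_choose_pred 4 1)
      have h2 : (2 : ℝ) ≤ (johnsonGraph 4 2).indepNum := by
        exact_mod_cast two_le_indepNum_johnsonGraph_four_two
      change (Fintype.card (JohnsonVertex 4 2) : ℝ) - ((johnsonGraph 4 2).indepNum : ℝ)
        ≤ (1 / 2 : ℝ) * (johnsonGraph 4 2).energy
      rw [card_johnsonVertex] at hE ⊢
      norm_num [Nat.choose] at hE ⊢
      linarith
    · have h1 := rank_adjMatrix_add_le_choose_pred (2 * (a + 1 + 2)) (a + 1 + 1)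
      rw [show (((a + 1 + 1 : ℕ) : ℝ) + 1) = ((a + 1 : ℕ) : ℝ) + 2 by push_cast; ring] at h1
      have hE := (johnsonGraph (2 * (a + 1 + 2)) (a + 1 + 2)).two_eigenvalues_le_half_energy
        (by push_cast; linarith [Nat.cast_nonneg (α := ℝ) a]) h1 (rank_quadratic_middle_le_choose (a + 1))
      rw [card_johnsonVertex] at hE ⊢
      have := choose_middle_le (a := a + 1) (by omega)
      linarith
  · rcases k with _ | a
    · rw [card_johnsonVertex]
      simp only [Nat.choose_zero_right, Nat.cast_one]
      linarith
    have hE := (johnsonGraph r (a + 1)).mul_card_sub_le_half_energy (by positivity)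
      (rank_adjMatrix_add_le_choose_pred r a)
    rw [card_johnsonVertex] at hE ⊢
    rcases Nat.eq_zero_or_pos a with rfl | ha
    · simp only [Nat.choose_zero_right, Nat.cast_zero, zero_add, one_mul, Nat.cast_one] at hE hα ⊢
      linarith
    · have := choose_le_mul_choose_sub ha h
      linarith

theorem mainTheorem8 (r k : ℕ) :
    (∑ i with 0 < (johnsonGraph r k).adjEigenvalue i, (johnsonGraph r k).adjEigenvalue i) =
        (1 / 2 : ℝ) * (johnsonGraph r k).energy ∧
      (1 / 2 : ℝ) * (johnsonGraph r k).energy ≥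
        (Fintype.card (JohnsonVertex r k) : ℝ) - ((johnsonGraph r k).indepNum : ℝ) :=
  ⟨(johnsonGraph r k).sum_pos_adjEigenvalue, card_sub_indepNum_le_half_energy_johnsonGraph r k⟩
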